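/- **Conventions.** $C^*$-algebras are unital, $^*$-homomorphisms between them are unital, $\otimes$ is the minimal tensor product, and $[n]=\{1,\dots,n\}$. A *two-coloured partition* $p$ with $k$ upper and $l$ lower points is a partition of these $k+l$ points into non-empty blocks, together with colours $\omega\in\{1,*\}^k$ of the upper and $\omega'\in\{1,*\}^l$ of the lower points. A *through-block* is a block with both upper and lower points. A labeling of a row of points is *valid* if points of the row in the same block have the same label. Fix $N$, and let $i$ run through the labelings of the through-blocks of $p$ by elements of $[N]$. Let $T_i\subseteq[N]^k$ (resp. $T'_i\subseteq[N]^l$) be the set of all valid labelings of the upper (resp. lower) row that restrict to $i$ on the through-block points, and let $T_0$ (resp. $T'_0$) be the set of invalid labelings of the upper (resp. lower) row. For $d\le N$ and a family $x=(x_{ij})_{i\in[N],\,j\in[d]}$ in a $C^*$-algebra, the relations $R^{Sp}_p(x)$ are 1. $\sum_{t\in T_i}x_{t_1\gamma_1}^{\omega_1}\cdots x_{t_k\gamma_k}^{\omega_k}=\sum_{t'\in T'_i}x_{t'_1\gamma'_1}^{\omega'_1}\cdots x_{t'_l\gamma'_l}^{\omega'_l}$ for all through-block labelings $i,j$ and all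 $\gamma\in T_j\cap[d]^k$, $\gamma'\in T'_j\cap[d]^l$; 2. $\sum_{t\in T_i}x_{t_1\gamma_1}^{\omega_1}\cdots x_{t_k\gamma_k}^{\omega_k}=0$ for all $i$ and all $\gamma\in T_0\cap[d]^k$; 3. $\sum_{t'\in T'_i}x_{t'_1\gamma'_1}^{\omega'_1}\cdots x_{t'_l\gamma'_l}^{\omega'_l}=0$ for all $i$ and all $\gamma'\in T'_0\cap[d]^l$, where an empty product is $1$. Let $1\le d\le N$ and let $\Pi$ be a set of two-coloured partitions containing the four mixed-coloured pair partitions (one block consisting of two points of different colours, both in the lower row or both in the upper row). Then $C(X_{N,d}(\Pi))$ denotes the universal unital $C^*$-algebra generated by elements $x_{ij}$ ($i\in[N]$, $j\in[d]$) subject to the relations $R^{Sp}_p(x)$ for all $p\in\Pi$. A *compact matrix quantum group* $G$ with matrix of generators $v=(v_{ij})_{i,j\in[N]}$ is given by a unital $C^*$-algebra $C(G)$ generated by the $v_{ij}$ such that $(v_{ij})$ and $(v_{ij}^*)$ are invertible matrices and there is a $^*$-homomorphism $\Delta:C(G)\to C(G)\otimes C(G)$ with $\Delta(v_{ij})=\sum_k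 v_{ik}\otimes v_{kj}$. It acts on $X_{N,d}(\Pi)$ from the left (resp. right) if there is a $^*$-homomorphism $C(X_{N,d}(\Pi))\to C(G)\otimes C(X_{N,d}(\Pi))$ with $x_{ij}\mapsto\sum_k v_{ik}\otimes x_{kj}$ (resp. $x_{ij}\mapsto\sum_k v_{ki}\otimes x_{kj}$). $G$ is the *quantum symmetry group* of $X_{N,d}(\Pi)$ if it acts from the left and from the right and if, for every compact matrix quantum group $G'$ with generators $(v'_{ij})_{i,j\in[N]}$ that acts from the left and from the right, there is a $^*$-homomorphism $C(G)\to C(G')$ with $v_{ij}\mapsto v'_{ij}$. **Theorem.** Let $1\le d\le N$, let $\Pi$ be a set of two-coloured partitions containing the four mixed-coloured pair partitions, and let $G$, with matrix of generators $v=(v_{ij})$, be the quantum symmetry group of $X_{N,d}(\Pi)$. For any $\sigma_1,\sigma_2\in S_N$ the assignments $$\phi:\ x_{ij}\mapsto v_{\sigma_1(i)\sigma_2(j)},\qquad \phi^T:\ x_{ij}\mapsto v_{\sigma_2(j)\sigma_1(i)}\qquad(i\in[N],\ j\in[d])$$ each extend uniquely to a $^*$-homomorphism $C(X_{N,d}(\Pi))\to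 C(G)$. In particular, $x_{ij}\mapsto v_{ij}$ extends uniquely to a $^*$-homomorphism $C(X_{N,d}(\Pi))\to C(G)$, and for every $p\in\Pi$ and every injective map $c:[d]\to[N]$ the relations $R^{Sp}_p$ hold for the columns $c(1),\dots,c(d)$ of $v$ and of $v^T$, that is, for $(v_{i\,c(j)})_{i\in[N],j\in[d]}$ and for $(v_{c(j)\,i})_{i\in[N],j\in[d]}$. -/

import Mathlib

noncomputable section

open scoped TensorProduct ENNReal ComplexOrder

namespace PartitionQuantumSpace

/-! ### Two-coloured partitions and their labelings -/

/-- The colours of points: `white` stands for the exponent `1`, `black` for the exponent `*`. -/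
inductive Colour
  | white
  | black

/-- A two-coloured partition with `k` upper and `l` lower points. The upper points are
`Sum.inl a`, the lower points are `Sum.inr b`, both numbered from left to right; the blocks are
the classes of the equivalence relation `blocks`. -/
structure TwoColouredPartition where
  k : ℕ
  l : ℕ
  upper : Fin k → Colour
  lower : Fin l → Colour
  blocks : Setoid (Fin k ⊕ Fin l)

namespace TwoColouredPartition

variable (p : TwoColouredPartition)

/-- The block of a point. -/
def blockOf (a : Fin p.k ⊕ Fin p.l) : Quotient p.blocks := Quotient.mk p.blocks a

/-- A block is a through-block if it contains both upper and lower points. -/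
def IsThrough (b : Quotient p.blocks) : Prop :=
  (∃ a, p.blockOf (Sum.inl a) = b) ∧ ∃ a', p.blockOf (Sum.inr a') = b

/-- The type of through-blocks. -/
def ThroughBlock : Type := {b : Quotient p.blocks // p.IsThrough b}

/-- Valid labelings of the upper row: connected upper points carry the same label. -/
def UpperValid {N : ℕ} (t : Fin p.k → Fin N) : Prop :=
  ∀ a b, p.blockOf (Sum.inl a) = p.blockOf (Sum.inl b) → t a = t b

/-- Valid labelings of the lower row: connected lower points carry the same label. -/
def LowerValid {N : ℕ} (t : Fin p.l → Fin N) : Prop :=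
  ∀ a b, p.blockOf (Sum.inr a) = p.blockOf (Sum.inr b) → t a = t b

/-- For a labeling `i` of the through-blocks by `[N]` (there are `N ^ tb(p)` of them), the set
`T_i` of all valid labelings of the upper row that label the through-blocks according to `i`. -/
def T {N : ℕ} (i : p.ThroughBlock → Fin N) : Set (Fin p.k → Fin N) :=
  {t | p.UpperValid t ∧ ∀ a (h : p.IsThrough (p.blockOf (Sum.inl a))), t a = i ⟨_, h⟩}

/-- For a labeling `i` of the through-blocks by `[N]`, the set `T'_i` of all valid labelings of the
lower row that label the through-blocks according to `i`. -/
def T' {N : ℕ} (i : p.ThroughBlock → Fin N) : Set (Fin p.l → Fin N) :=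
  {t | p.LowerValid t ∧ ∀ a (h : p.IsThrough (p.blockOf (Sum.inr a))), t a = i ⟨_, h⟩}

/-- The set `T_0` of invalid labelings of the upper row. -/
def T₀ (N : ℕ) : Set (Fin p.k → Fin N) := {t | ¬ p.UpperValid t}

/-- The set `T'_0` of invalid labelings of the lower row. -/
def T'₀ (N : ℕ) : Set (Fin p.l → Fin N) := {t | ¬ p.LowerValid t}

end TwoColouredPartition

/-- The pair partition whose two points, of colours `c₁` and `c₂`, lie in the lower row. -/
abbrev lowerPair (c₁ c₂ : Colour) : TwoColouredPartition where
  k := 0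
  l := 2
  upper := ![]
  lower := ![c₁, c₂]
  blocks := ⊤

/-- The pair partition whose two points, of colours `c₁` and `c₂`, lie in the upper row. -/
abbrev upperPair (c₁ c₂ : Colour) : TwoColouredPartition where
  k := 2
  l := 0
  upper := ![c₁, c₂]
  lower := ![]
  blocks := ⊤

/-- The four mixed-coloured pair partitions. -/
def mixedColouredPairPartitions : Set TwoColouredPartition :=
  {lowerPair .white .black, lowerPair .black .white,
    upperPair .white .black, upperPair .black .white}

/-! ### The quantum space relations -/

/-- `a ^ ω` for a colour `ω`: `a` itself or its adjoint. -/
def colourPow {A : Type*} [Star A] (a : A) : Colour → A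
  | .white => a
  | .black => star a

/-- The product `x_{t₁γ₁}^{ω₁} ⋯ x_{tₖγₖ}^{ωₖ}` (equal to `1` for `k = 0`). -/
def word {A : Type*} [Ring A] [Star A] {N d k : ℕ} (x : Fin N → Fin d → A) (ω : Fin k → Colour)
    (t : Fin k → Fin N) (γ : Fin k → Fin d) : A :=
  (List.ofFn fun m => colourPow (x (t m) (γ m)) (ω m)).prod

open Classical in
/-- The sum of the products `x_{t₁γ₁}^{ω₁} ⋯ x_{tₖγₖ}^{ωₖ}` over all `t ∈ S`. -/
def wordSum {A : Type*} [Ring A] [Star A] {N d k : ℕ} (x : Fin N → Fin d → A) (ω : Fin k → Colour)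
    (S : Set (Fin k → Fin N)) (γ : Fin k → Fin d) : A :=
  ∑ t : Fin k → Fin N with t ∈ S, word x ω t γ

/-- A multi-index in `[d]^k`, regarded as an element of `[N]^k` for `d ≤ N`. -/
def castIdx {N d k : ℕ} (hd : d ≤ N) (γ : Fin k → Fin d) : Fin k → Fin N :=
  fun m => Fin.castLE hd (γ m)

/-- The quantum space relations `R^Sp_p(x)` for a `d`-tuple `x = (x_{ij})` of vectors of length
`N` with entries in a `*`-ring. -/
structure SpaceRelations {A : Type*} [Ring A] [Star A] {N d : ℕ} (hd : d ≤ N)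
    (p : TwoColouredPartition) (x : Fin N → Fin d → A) : Prop where
  rel_eq : ∀ (i j : p.ThroughBlock → Fin N) (γ : Fin p.k → Fin d) (γ' : Fin p.l → Fin d),
    castIdx hd γ ∈ p.T j → castIdx hd γ' ∈ p.T' j →
      wordSum x p.upper (p.T i) γ = wordSum x p.lower (p.T' i) γ'
  rel_upper : ∀ (i : p.ThroughBlock → Fin N) (γ : Fin p.k → Fin d),
    castIdx hd γ ∈ p.T₀ N → wordSum x p.upper (p.T i) γ = 0
  rel_lower : ∀ (i : p.ThroughBlock → Fin N) (γ' : Fin p.l → Fin d),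
    castIdx hd γ' ∈ p.T'₀ N → wordSum x p.lower (p.T' i) γ' = 0

/-- The relation of the lower white-black pair partition: `∑_t x_{tj} x_{tj}^* = 1`. -/
theorem SpaceRelations.sum_mul_star {A : Type*} [Ring A] [Star A] {N d : ℕ} {hd : d ≤ N}
    {x : Fin N → Fin d → A} (h : SpaceRelations hd (lowerPair .white .black) x) (j : Fin d) :
    ∑ t, x t j * star (x t j) = 1 := by
  classical
  have hno : ∀ b, ¬ (lowerPair .white .black).IsThrough b := by
    rintro b ⟨⟨a, -⟩, -⟩
    exact Fin.elim0 a
  have hv : ∀ {M : ℕ} (t : Fin (lowerPair .white .black).l → Fin M),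
      (lowerPair .white .black).LowerValid t ↔ t (0 : Fin 2) = t (1 : Fin 2) := by
    intro M t
    constructor
    · intro ht
      exact ht _ _ (Quotient.sound (s := (lowerPair .white .black).blocks) trivial)
    · intro ht a b _
      change Fin 2 at a b
      fin_cases a <;> fin_cases b <;> first | rfl | exact ht | exact ht.symm
  let i : (lowerPair .white .black).ThroughBlock → Fin N := fun b => (hno _ b.2).elim
  have key := h.rel_eq i i (fun a => Fin.elim0 a) (fun _ => j)
    ⟨fun a => Fin.elim0 a, fun a => Fin.elim0 a⟩ ⟨(hv _).2 rfl, fun a ha => (hno _ ha).elim⟩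
  have h1 : wordSum x (lowerPair .white .black).upper ((lowerPair .white .black).T i)
      (fun a => Fin.elim0 a) = 1 := by
    unfold wordSum
    rw [Finset.sum_eq_single (fun a : Fin 0 => Fin.elim0 a)]
    · simp [word, lowerPair]
    · intro b _ hb
      exact (hb (funext fun a => Fin.elim0 a)).elim
    · intro hb
      exact (hb (by simp only [Finset.mem_filter, Finset.mem_univ, true_and]
                    exact ⟨fun a => Fin.elim0 a, fun a => Fin.elim0 a⟩)).elim
  rw [h1] at key
  rw [key]
  unfold wordSum
  refine Finset.sum_bij (fun t _ => (fun _ : Fin 2 => t)) ?_ ?_ ?_ ?_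
  · intro t _
    simp only [Finset.mem_filter, Finset.mem_univ, true_and]
    exact ⟨(hv _).2 rfl, fun a ha => (hno _ ha).elim⟩
  · intro a _ b _ hab
    exact congrFun hab 0
  · intro t ht
    simp only [Finset.mem_filter, Finset.mem_univ, true_and] at ht
    refine ⟨t (0 : Fin 2), Finset.mem_univ _, ?_⟩
    have := (hv t).1 ht.1
    funext m
    change Fin 2 at m
    fin_cases m
    · rfl
    · exact this
  · intro t _
    simp [word, lowerPair, colourPow, List.ofFn_succ]

/-! ### Bounded products of C⋆-algebras -/

/-- The bounded product (`ℓ^∞`-direct product) of nonzero unital C⋆-algebras is a unital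
C⋆-algebra with componentwise operations and the supremum norm. -/
instance boundedProduct {I : Type*} {B : I → Type*} [∀ i, CStarAlgebra (B i)]
    [∀ i, Nontrivial (B i)] : CStarAlgebra (lp B ∞) where
  __ := (inferInstance : NormedAlgebra ℂ (lp B ∞))
  __ := (inferInstance : StarModule ℂ (lp B ∞))
  __ := (inferInstance : CStarRing (lp B ∞))
  __ := (inferInstance : CompleteSpace (lp B ∞))

/-- The closed unital `*`-subalgebra generated by a set. -/
def closedAdjoin {B : Type*} [CStarAlgebra B] (s : Set B) : StarSubalgebra ℂ B :=
  (StarAlgebra.adjoin ℂ s).topologicalClosure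

instance {B : Type*} [CStarAlgebra B] (s : Set B) : IsClosed (closedAdjoin s : Set B) :=
  StarSubalgebra.isClosed_topologicalClosure _

theorem subset_closedAdjoin {B : Type*} [CStarAlgebra B] (s : Set B) :
    s ⊆ (closedAdjoin s : Set B) :=
  (StarAlgebra.subset_adjoin ℂ s).trans (StarSubalgebra.le_topologicalClosure _)

/-! ### The minimal tensor product of C⋆-algebras -/

section MinTensor

attribute [local instance] CStarAlgebra.spectralOrder CStarAlgebra.spectralOrderedRing

/-- The states of a unital C⋆-algebra: positive linear functionals `f` with `f 1 = 1`. Positivity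
refers to the canonical order of the C⋆-algebra. -/
def State (A : Type*) [CStarAlgebra A] : Type _ := {f : A →ₚ[ℂ] ℂ // f 1 = 1}

/-- The GNS Hilbert space of a state. -/
abbrev State.GNS {A : Type*} [CStarAlgebra A] (f : State A) : Type _ := f.1.GNS

/-- The GNS representation of a state. -/
def State.rep {A : Type*} [CStarAlgebra A] (f : State A) : A →⋆ₐ[ℂ] (f.GNS →L[ℂ] f.GNS) :=
  f.1.gnsStarAlgHom

/-- The canonical cyclic unit vector of the GNS space of a state. -/
def State.vec {A : Type*} [CStarAlgebra A] (f : State A) : f.GNS :=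
  ((f.1.toPreGNS 1 : f.1.PreGNS) : f.1.GNS)

theorem State.norm_vec {A : Type*} [CStarAlgebra A] (f : State A) : ‖f.vec‖ = 1 := by
  rw [State.vec, UniformSpace.Completion.norm_coe, PositiveLinearMap.preGNS_norm_def]
  simp [f.2]

variable (A B : Type*) [CStarAlgebra A] [CStarAlgebra B]

/-- The Hilbert space tensor product of the GNS spaces of two states. -/
abbrev GNSTensor (s : State A × State B) : Type _ :=
  UniformSpace.Completion (s.1.GNS ⊗[ℂ] s.2.GNS)

instance (s : State A × State B) : Nontrivial (GNSTensor A B s) := by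
  refine ⟨⟨((s.1.vec ⊗ₜ[ℂ] s.2.vec : s.1.GNS ⊗[ℂ] s.2.GNS) : GNSTensor A B s), 0, fun h => ?_⟩⟩
  have h' := congrArg norm h
  rw [UniformSpace.Completion.norm_coe, TensorProduct.norm_tmul, State.norm_vec,
    State.norm_vec, norm_zero] at h'
  norm_num at h'

instance (s : State A × State B) : CStarAlgebra (GNSTensor A B s →L[ℂ] GNSTensor A B s) where

/-- The bounded product, over all pairs `(f, g)` of states of `A` and `B`, of the algebras of bounded
operators on the Hilbert space tensor product of the GNS spaces of `f` and `g`. -/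
abbrev GNSTensorProduct : Type _ := lp (fun s => GNSTensor A B s →L[ℂ] GNSTensor A B s) ∞

variable {A B}

/-- The operator `π_f(a) ⊗ π_g(b)` on the Hilbert space tensor product of the GNS spaces. -/
def tensorOp (s : State A × State B) (a : A) (b : B) : GNSTensor A B s →L[ℂ] GNSTensor A B s :=
  (TensorProduct.mapL (s.1.rep a) (s.2.rep b)).completion

theorem norm_tensorOp_le (s : State A × State B) (a : A) (b : B) :
    ‖tensorOp s a b‖ ≤ ‖a‖ * ‖b‖ := by
  have h : ‖TensorProduct.mapL (s.1.rep a) (s.2.rep b)‖ ≤ ‖a‖ * ‖b‖ :=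
    (TensorProduct.norm_mapL_le _ _).trans
      (mul_le_mul (NonUnitalStarAlgHom.norm_apply_le _ a) (NonUnitalStarAlgHom.norm_apply_le _ b)
        (norm_nonneg _) (norm_nonneg _))
  refine ContinuousLinearMap.opNorm_le_bound _ (by positivity) fun z => ?_
  induction z using UniformSpace.Completion.induction_on with
  | hp => exact isClosed_le (by fun_prop) (by fun_prop)
  | ih z =>
    rw [tensorOp, ContinuousLinearMap.completion_apply_coe, UniformSpace.Completion.norm_coe,
      UniformSpace.Completion.norm_coe]
    exact ContinuousLinearMap.le_of_opNorm_le _ h z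

/-- The elementary tensor `a ⊗ b`, represented on all the spaces `H_f ⊗ H_g`. -/
def elemTensor (a : A) (b : B) : GNSTensorProduct A B :=
  ⟨fun s => tensorOp s a b,
    memℓp_infty ⟨‖a‖ * ‖b‖, by rintro _ ⟨s, rfl⟩; exact norm_tensorOp_le s a b⟩⟩

variable (A B) in
/-- The minimal (spatial) tensor product of two unital C⋆-algebras: the C⋆-algebra generated by
(equivalently, the closed linear span of) the elementary tensors in the tensor product of the
universal representations of `A` and `B`. -/
def MinTensor : Type _ :=
  closedAdjoin {z : GNSTensorProduct A B | ∃ a b, z = elemTensor a b}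

instance : CStarAlgebra (MinTensor A B) :=
  inferInstanceAs (CStarAlgebra
    (closedAdjoin {z : GNSTensorProduct A B | ∃ a b, z = elemTensor a b}))

/-- The elementary tensor `a ⊗ b` in the minimal tensor product. -/
def MinTensor.tmul (a : A) (b : B) : MinTensor A B :=
  ⟨elemTensor a b, subset_closedAdjoin _ ⟨a, b, rfl⟩⟩

end MinTensor

/-! ### Partition quantum spaces -/

section Space

universe u

/-- A nonzero unital C⋆-algebra together with a `d`-tuple of vectors of length `N` that satisfies
the quantum space relations of all partitions in `P`. -/
structure SpaceModel {N d : ℕ} (hd : d ≤ N) (P : Set TwoColouredPartition) :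
    Type (u + 1) where
  alg : Type u
  [cstar : CStarAlgebra alg]
  [nontrivial : Nontrivial alg]
  x : Fin N → Fin d → alg
  rel : ∀ p ∈ P, SpaceRelations hd p x

attribute [instance] SpaceModel.cstar SpaceModel.nontrivial

variable {N d : ℕ} {hd : d ≤ N} {P : Set TwoColouredPartition}

theorem SpaceModel.norm_le_one (hP : mixedColouredPairPartitions ⊆ P)
    (M : SpaceModel.{u} hd P) (i : Fin N) (j : Fin d) : ‖M.x i j‖ ≤ 1 := by
  let _ := CStarAlgebra.spectralOrder M.alg
  have _ := CStarAlgebra.spectralOrderedRing M.alg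
  have h := (M.rel _ (hP (by simp [mixedColouredPairPartitions]))).sum_mul_star j
  have h1 : M.x i j * star (M.x i j) ≤ 1 := by
    rw [← h]
    exact Finset.single_le_sum (f := fun t => M.x t j * star (M.x t j))
      (fun t _ => mul_star_self_nonneg _) (Finset.mem_univ i)
  have h2 := CStarAlgebra.norm_le_norm_of_nonneg_of_le (mul_star_self_nonneg _) h1
  rw [CStarRing.norm_self_mul_star, norm_one] at h2
  nlinarith [norm_nonneg (M.x i j)]

/-- The tuple of all models at once, as elements of the bounded product of all models. -/
def universalTuple (hd : d ≤ N) (hP : mixedColouredPairPartitions ⊆ P) (i : Fin N) (j : Fin d) :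
    lp (fun M : SpaceModel.{u} hd P => M.alg) ∞ :=
  ⟨fun M => M.x i j, memℓp_infty ⟨1, by rintro _ ⟨M, rfl⟩; exact M.norm_le_one hP i j⟩⟩

/-- The universal C⋆-algebra `C(X_{N,d}(P))` generated by `x_{ij}` (`i ∈ [N]`, `j ∈ [d]`) subject to
the relations `R^Sp_p(x)`, `p ∈ P`: the C⋆-algebra generated by the universal tuple inside the
bounded product of all C⋆-algebras with a tuple that satisfies the relations. -/
def SpaceAlgebra (hd : d ≤ N) (hP : mixedColouredPairPartitions ⊆ P) : Type (u + 1) :=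
  closedAdjoin {z | ∃ i j, z = universalTuple.{u} hd hP i j}

variable {hP : mixedColouredPairPartitions ⊆ P}

instance : CStarAlgebra (SpaceAlgebra.{u} hd hP) :=
  inferInstanceAs (CStarAlgebra (closedAdjoin {z | ∃ i j, z = universalTuple.{u} hd hP i j}))

/-- The generators `x_{ij}` of `C(X_{N,d}(P))`. -/
def SpaceAlgebra.gen (hd : d ≤ N) (hP : mixedColouredPairPartitions ⊆ P) (i : Fin N) (j : Fin d) :
    SpaceAlgebra.{u} hd hP :=
  ⟨universalTuple hd hP i j, subset_closedAdjoin _ ⟨i, j, rfl⟩⟩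

end Space

/-! ### Compact matrix quantum groups, actions and quantum symmetry groups -/

section Groups

universe u w

/-- The matrix `v` with entries in the unital C⋆-algebra `A` is the matrix of generators of a compact
matrix quantum group `G` with `C(G) = A`. -/
structure IsCompactMatrixQuantumGroup {A : Type*} [CStarAlgebra A] {N : ℕ}
    (v : Matrix (Fin N) (Fin N) A) : Prop where
  generates : closedAdjoin {a | ∃ i j, a = v i j} = ⊤
  isUnit : IsUnit v
  isUnit_conj : IsUnit (v.map star)
  comul : ∃ Δ : A →⋆ₐ[ℂ] MinTensor A A,
    ∀ i j, Δ (v i j) = ∑ k, MinTensor.tmul (v i k) (v k j)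

/-- There is a left matrix-vector action of the quantum group with matrix of generators `v` on the
quantum space of `d` vectors with generators `x`. -/
def HasLeftAction {A C : Type*} [CStarAlgebra A] [CStarAlgebra C] {N d : ℕ}
    (v : Matrix (Fin N) (Fin N) A) (x : Fin N → Fin d → C) : Prop :=
  ∃ α : C →⋆ₐ[ℂ] MinTensor A C, ∀ i j, α (x i j) = ∑ k, MinTensor.tmul (v i k) (x k j)

/-- There is a right matrix-vector action of the quantum group with matrix of generators `v` on the
quantum space of `d` vectors with generators `x`. -/
def HasRightAction {A C : Type*} [CStarAlgebra A] [CStarAlgebra C] {N d : ℕ}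
    (v : Matrix (Fin N) (Fin N) A) (x : Fin N → Fin d → C) : Prop :=
  ∃ β : C →⋆ₐ[ℂ] MinTensor A C, ∀ i j, β (x i j) = ∑ k, MinTensor.tmul (v k i) (x k j)

/-- The quantum group `G` with matrix of generators `v` is the quantum symmetry group of the quantum
space of `d` vectors with generators `x`: it acts from the left and from the right, and every compact
matrix quantum group `G'` acting from the left and from the right satisfies `G' ⊆ G`, that is, there
is a `*`-homomorphism `C(G) → C(G')` sending the generators `v_{ij}` to the generators `v'_{ij}`. -/
structure IsQuantumSymmetryGroup {A : Type u} {C : Type w} [CStarAlgebra A] [CStarAlgebra C]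
    {N d : ℕ} (v : Matrix (Fin N) (Fin N) A) (x : Fin N → Fin d → C) : Prop where
  isCMQG : IsCompactMatrixQuantumGroup v
  left : HasLeftAction v x
  right : HasRightAction v x
  maximal : ∀ (A' : Type u) [CStarAlgebra A'] (v' : Matrix (Fin N) (Fin N) A'),
    IsCompactMatrixQuantumGroup v' → HasLeftAction v' x → HasRightAction v' x →
      ∃ ψ : A →⋆ₐ[ℂ] A', ∀ i j, ψ (v i j) = v' i j

end Groups

end PartitionQuantumSpace

end

universe u

open PartitionQuantumSpace

/-!
For an injective `c : [d] → [N]`, the columns `c(1), …, c(d)` of the identity matrix satisfy all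
relations `R^Sp_p`, since there a word is `1` if `t = c ∘ γ` and `0` otherwise. They define a
character `ε` of `C(X_{N,d}(P))`. Composing a left action `x_{ij} ↦ ∑_k v_{ik} ⊗ x_{kj}` with the
slice map `id ⊗ ε` gives `x_{ij} ↦ v_{i c(j)}`. The relations are invariant under permutations of
the rows, so that also `x_{ij} ↦ v_{σ(i) c(j)}` is a `*`-homomorphism. A right action of `v` is a
left action of the transpose of `v`.

The slice map exists because the GNS space of a character is the line spanned by its cyclic vector
`ξ`: for a state `f` of `A`, the unitary `x ↦ x ⊗ ξ` intertwines `π_f(ε(b) a)` and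
`π_f(a) ⊗ π_ε(b)`. Since the representations `π_f` are jointly faithful, the compressions of the
minimal tensor product to all the GNS spaces together take values in the image of `A`.
-/

noncomputable section

open scoped TensorProduct ENNReal ComplexOrder CStarAlgebra

namespace PartitionQuantumSpace

theorem map_colourPow {A B F : Type*} [Star A] [Star B] [FunLike F A B] [StarHomClass F A B]
    (φ : F) (a : A) (c : Colour) : φ (colourPow a c) = colourPow (φ a) c := by
  cases c with
  | white => rfl
  | black => exact map_star φ a

section Homomorphisms

variable {A B F : Type*} [Ring A] [Star A] [Ring B] [Star B] [FunLike F A B]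
  [RingHomClass F A B] [StarHomClass F A B] {N d k : ℕ}

theorem map_word (φ : F) (x : Fin N → Fin d → A) (ω : Fin k → Colour) (t : Fin k → Fin N)
    (γ : Fin k → Fin d) : φ (word x ω t γ) = word (fun i j => φ (x i j)) ω t γ := by
  simp only [word, map_list_prod, List.map_ofFn, Function.comp_def, map_colourPow]

theorem map_wordSum (φ : F) (x : Fin N → Fin d → A) (ω : Fin k → Colour)
    (S : Set (Fin k → Fin N)) (γ : Fin k → Fin d) :
    φ (wordSum x ω S γ) = wordSum (fun i j => φ (x i j)) ω S γ := by
  simp only [wordSum, map_sum, map_word]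

variable {hd : d ≤ N} {p : TwoColouredPartition} {x : Fin N → Fin d → A}

theorem SpaceRelations.map (φ : F) (h : SpaceRelations hd p x) :
    SpaceRelations hd p (fun i j => φ (x i j)) where
  rel_eq i j γ γ' hγ hγ' := by
    rw [← map_wordSum, ← map_wordSum, h.rel_eq i j γ γ' hγ hγ']
  rel_upper i γ hγ := by rw [← map_wordSum, h.rel_upper i γ hγ, map_zero]
  rel_lower i γ hγ := by rw [← map_wordSum, h.rel_lower i γ hγ, map_zero]

end Homomorphisms

theorem SpaceRelations.of_forall_map {A I : Type*} [Ring A] [Star A] {B F : I → Type*}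
    [∀ s, Ring (B s)] [∀ s, Star (B s)] [∀ s, FunLike (F s) A (B s)]
    [∀ s, RingHomClass (F s) A (B s)] [∀ s, StarHomClass (F s) A (B s)] (φ : ∀ s, F s)
    (hφ : Function.Injective fun a s => φ s a) {N d : ℕ} {hd : d ≤ N} {p : TwoColouredPartition}
    {x : Fin N → Fin d → A} (h : ∀ s, SpaceRelations hd p (fun i j => φ s (x i j))) :
    SpaceRelations hd p x where
  rel_eq i j γ γ' hγ hγ' := hφ <| funext fun s => by
    simpa only [map_wordSum] using (h s).rel_eq i j γ γ' hγ hγ'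
  rel_upper i γ hγ := hφ <| funext fun s => by
    simpa only [map_wordSum, map_zero] using (h s).rel_upper i γ hγ
  rel_lower i γ hγ := hφ <| funext fun s => by
    simpa only [map_wordSum, map_zero] using (h s).rel_lower i γ hγ

namespace TwoColouredPartition

variable (p : TwoColouredPartition) {M N : ℕ} {f : Fin M → Fin N}

theorem preimage_comp_T (hf : Function.Injective f) (i : p.ThroughBlock → Fin M) :
    (f ∘ ·) ⁻¹' p.T (f ∘ i) = p.T i := by
  ext t
  refine and_congr ?_ (forall₂_congr fun _ _ => hf.eq_iff)
  simp only [UpperValid, Function.comp_apply, hf.eq_iff]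

theorem preimage_comp_T' (hf : Function.Injective f) (i : p.ThroughBlock → Fin M) :
    (f ∘ ·) ⁻¹' p.T' (f ∘ i) = p.T' i := by
  ext t
  refine and_congr ?_ (forall₂_congr fun _ _ => hf.eq_iff)
  simp only [LowerValid, Function.comp_apply, hf.eq_iff]

variable {p} {i j : p.ThroughBlock → Fin N}

theorem mem_T_iff_eq_of_mem {t : Fin p.k → Fin N} (ht : t ∈ p.T j) : t ∈ p.T i ↔ i = j := by
  refine ⟨fun h => ?_, fun h => h ▸ ht⟩
  funext ⟨b, hb⟩
  obtain ⟨a, rfl⟩ := hb.1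
  rw [← h.2 a hb, ht.2 a hb]

theorem mem_T'_iff_eq_of_mem {t : Fin p.l → Fin N} (ht : t ∈ p.T' j) : t ∈ p.T' i ↔ i = j := by
  refine ⟨fun h => ?_, fun h => h ▸ ht⟩
  funext ⟨b, hb⟩
  obtain ⟨a, rfl⟩ := hb.2
  rw [← h.2 a hb, ht.2 a hb]

end TwoColouredPartition

section Rows

variable {A : Type*} [Ring A] [Star A] {N d k : ℕ}

theorem wordSum_permRows (σ : Equiv.Perm (Fin N)) (x : Fin N → Fin d → A) (ω : Fin k → Colour)
    (S : Set (Fin k → Fin N)) (γ : Fin k → Fin d) :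
    wordSum (fun i => x (σ i)) ω ((σ ∘ ·) ⁻¹' S) γ = wordSum x ω S γ := by
  classical
  refine Finset.sum_equiv ((Equiv.refl _).arrowCongr σ) (fun t => ?_) fun t _ => rfl
  simp only [Finset.mem_filter, Finset.mem_univ, true_and]
  rfl

theorem SpaceRelations.permRows {hd : d ≤ N} {p : TwoColouredPartition} {x : Fin N → Fin d → A}
    (h : SpaceRelations hd p x) (σ : Equiv.Perm (Fin N)) :
    SpaceRelations hd p (fun i => x (σ i)) where
  rel_eq i j γ γ' hγ hγ' := by
    rw [← p.preimage_comp_T σ.injective, ← p.preimage_comp_T' σ.injective, wordSum_permRows,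
      wordSum_permRows]
    exact h.rel_eq _ j γ γ' hγ hγ'
  rel_upper i γ hγ := by
    rw [← p.preimage_comp_T σ.injective, wordSum_permRows]
    exact h.rel_upper _ γ hγ
  rel_lower i γ hγ := by
    rw [← p.preimage_comp_T' σ.injective, wordSum_permRows]
    exact h.rel_lower _ γ hγ

end Rows

section IdentityMatrix

variable {R : Type*} [CommRing R] [StarRing R] {N d k : ℕ}

theorem colourPow_one_apply (i j : Fin N) (c : Colour) :
    colourPow ((1 : Matrix (Fin N) (Fin N) R) i j) c = (1 : Matrix (Fin N) (Fin N) R) i j := by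
  cases c <;> simp [colourPow, Matrix.one_apply, apply_ite star]

theorem word_one (c : Fin d → Fin N) (ω : Fin k → Colour) (t : Fin k → Fin N)
    (γ : Fin k → Fin d) :
    word (fun i j => (1 : Matrix (Fin N) (Fin N) R) i (c j)) ω t γ =
      if t = c ∘ γ then 1 else 0 := by
  simp only [word, colourPow_one_apply, List.prod_ofFn]
  simp only [Matrix.one_apply, Finset.prod_ite_zero, Finset.prod_const_one, Finset.mem_univ,
    true_imp_iff, funext_iff, Function.comp_apply]

theorem wordSum_one (c : Fin d → Fin N) (ω : Fin k → Colour) (S : Set (Fin k → Fin N))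
    (γ : Fin k → Fin d) :
    wordSum (fun i j => (1 : Matrix (Fin N) (Fin N) R) i (c j)) ω S γ =
      S.indicator 1 (c ∘ γ) := by
  classical
  simp only [wordSum, word_one, Finset.sum_ite_eq', Finset.mem_filter, Finset.mem_univ, true_and,
    Set.indicator_apply, Pi.one_apply]

theorem SpaceRelations.one_castLE (hd : d ≤ N) (p : TwoColouredPartition) :
    SpaceRelations hd p (fun i j => (1 : Matrix (Fin N) (Fin N) R) i (Fin.castLE hd j)) where
  rel_eq i j γ γ' hγ hγ' := by
    classical
    simp only [wordSum_one, Set.indicator_apply]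
    exact if_congr ((TwoColouredPartition.mem_T_iff_eq_of_mem hγ).trans
      (TwoColouredPartition.mem_T'_iff_eq_of_mem hγ').symm) rfl rfl
  rel_upper i γ hγ := by
    rw [wordSum_one]
    exact Set.indicator_of_notMem (fun h => hγ h.1) _
  rel_lower i γ hγ := by
    rw [wordSum_one]
    exact Set.indicator_of_notMem (fun h => hγ h.1) _

theorem SpaceRelations.one_columns (hd : d ≤ N) (p : TwoColouredPartition) (c : Fin d ↪ Fin N) :
    SpaceRelations hd p (fun i j => (1 : Matrix (Fin N) (Fin N) R) i (c j)) := by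
  obtain ⟨σ, hσ⟩ := Equiv.Perm.exists_extending_pair (Fin.castLE hd) c
    (Fin.castLE_injective hd) c.injective
  simpa only [Matrix.one_apply, Equiv.symm_apply_eq, hσ] using
    (one_castLE (R := R) hd p).permRows σ.symm

end IdentityMatrix

section ClosedAdjoin

variable {B : Type*} [CStarAlgebra B]

theorem closedAdjoin_le {s : Set B} {S : StarSubalgebra ℂ B} (hS : IsClosed (S : Set B))
    (hs : s ⊆ S) : closedAdjoin s ≤ S :=
  StarSubalgebra.topologicalClosure_minimal (StarAlgebra.adjoin_le hs) hS

theorem closedAdjoin_preimage_coe (s : Set B) :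
    closedAdjoin ((↑) ⁻¹' s : Set (closedAdjoin s)) = ⊤ := by
  let S := closedAdjoin ((↑) ⁻¹' s : Set (closedAdjoin s))
  have hclosed : IsClosed (S.map (closedAdjoin s).subtype : Set B) :=
    IsClosed.isClosedMap_subtype_val (s := (closedAdjoin s : Set B)) inferInstance _
      (inferInstance : IsClosed (S : Set (closedAdjoin s)))
  have hle : closedAdjoin s ≤ S.map (closedAdjoin s).subtype :=
    closedAdjoin_le hclosed fun b hb =>
      ⟨⟨b, subset_closedAdjoin s hb⟩, subset_closedAdjoin _ hb, rfl⟩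
  refine eq_top_iff.mpr fun b _ => ?_
  obtain ⟨b', hb', h⟩ := hle b.2
  rwa [← Subtype.ext h]

variable {C : Type*} [CStarAlgebra C]

theorem starAlgHom_ext_of_closedAdjoin_eq_top {s : Set B} (hs : closedAdjoin s = ⊤)
    {φ ψ : B →⋆ₐ[ℂ] C} (h : Set.EqOn φ ψ s) : φ = ψ := by
  have hclosed : IsClosed (StarAlgHom.equalizer φ ψ : Set B) :=
    isClosed_eq (map_continuous φ) (map_continuous ψ)
  have hle := closedAdjoin_le hclosed h
  rw [hs] at hle
  exact StarAlgHom.ext fun b => hle trivial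

end ClosedAdjoin

section BoundedProduct

variable {I : Type*} {B : I → Type*} [∀ i, CStarAlgebra (B i)] [∀ i, Nontrivial (B i)]

/-- The projection of a bounded product of C⋆-algebras onto one of its factors. -/
def boundedProductEval (i : I) : lp B ∞ →⋆ₐ[ℂ] B i where
  toFun z := z i
  map_one' := rfl
  map_mul' _ _ := rfl
  map_zero' := rfl
  map_add' _ _ := rfl
  commutes' _ := rfl
  map_star' _ := rfl

variable {A C : Type*} [CStarAlgebra A] [CStarAlgebra C]

/-- The `*`-homomorphism into a bounded product of C⋆-algebras whose components are the given
`*`-homomorphisms; it exists because `*`-homomorphisms are contractive. -/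
def boundedProductLift (φ : ∀ i, A →⋆ₐ[ℂ] B i) : A →⋆ₐ[ℂ] lp B ∞ where
  toFun a := ⟨fun i => φ i a, memℓp_infty
    ⟨‖a‖, by rintro _ ⟨i, rfl⟩; exact NonUnitalStarAlgHom.norm_apply_le (φ i) a⟩⟩
  map_one' := lp.ext (funext fun i => map_one (φ i))
  map_mul' a b := lp.ext (funext fun i => map_mul (φ i) a b)
  map_zero' := lp.ext (funext fun i => map_zero (φ i))
  map_add' a b := lp.ext (funext fun i => map_add (φ i) a b)
  commutes' r := lp.ext (funext fun i => AlgHomClass.commutes (φ i) r)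
  map_star' a := lp.ext (funext fun i => map_star (φ i) a)

theorem exists_starAlgHom_of_jointly_injective {φ : ∀ i, A →⋆ₐ[ℂ] B i}
    (hφ : Function.Injective fun a i => φ i a) (Φ : ∀ i, C →⋆ₐ[ℂ] B i) {s : Set C}
    (hs : closedAdjoin s = ⊤) (hΦ : ∀ c ∈ s, ∃ a, ∀ i, φ i a = Φ i c) :
    ∃ Ψ : C →⋆ₐ[ℂ] A, ∀ c i, φ i (Ψ c) = Φ i c := by
  let φ' := boundedProductLift φ
  let Φ' := boundedProductLift Φ
  have hφ' : Function.Injective φ' := fun a b h =>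
    hφ (congrArg (fun z : lp B ∞ => (z : ∀ i, B i)) h)
  have hclosed : IsClosed (φ'.range.comap Φ' : Set C) := by
    have h := (NonUnitalStarAlgHom.isometry φ' hφ').isClosedEmbedding.isClosed_range
    exact h.preimage (map_continuous Φ')
  have hle := closedAdjoin_le hclosed fun c hc => by
    obtain ⟨a, ha⟩ := hΦ c hc
    exact ⟨a, lp.ext (funext ha)⟩
  have hrange : ∀ c, Φ' c ∈ φ'.range := fun c => hle (hs ▸ trivial)
  let e := StarAlgEquiv.ofInjective φ' hφ'
  refine ⟨(e.symm : φ'.range →⋆ₐ[ℂ] A).comp (Φ'.codRestrict _ hrange), fun c i => ?_⟩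
  have h : φ' (e.symm ⟨Φ' c, hrange c⟩) = Φ' c :=
    congrArg Subtype.val (e.apply_symm_apply ⟨Φ' c, hrange c⟩)
  exact congrArg (fun z : lp B ∞ => z i) h

end BoundedProduct

namespace SpaceAlgebra

variable {N d : ℕ} {hd : d ≤ N} {P : Set TwoColouredPartition}
  {hP : mixedColouredPairPartitions ⊆ P}

theorem closedAdjoin_range_gen :
    closedAdjoin {z : SpaceAlgebra.{u} hd hP | ∃ i j, z = gen hd hP i j} = ⊤ := by
  refine Eq.trans (congrArg closedAdjoin ?_) (closedAdjoin_preimage_coe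
    {z | ∃ i j, z = universalTuple.{u} hd hP i j})
  exact Set.ext fun z => exists₂_congr fun i j => Subtype.ext_iff

theorem hom_ext {B : Type*} [CStarAlgebra B] {φ ψ : SpaceAlgebra.{u} hd hP →⋆ₐ[ℂ] B}
    (h : ∀ i j, φ (gen hd hP i j) = ψ (gen hd hP i j)) : φ = ψ :=
  starAlgHom_ext_of_closedAdjoin_eq_top closedAdjoin_range_gen
    (by rintro _ ⟨i, j, rfl⟩; exact h i j)

/-- The representation of `C(X_{N,d}(P))` on a model, which sends the generators to the entries of
the tuple of the model. -/
def toModel (hP : mixedColouredPairPartitions ⊆ P) (M : SpaceModel.{u} hd P) :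
    SpaceAlgebra.{u} hd hP →⋆ₐ[ℂ] M.alg :=
  (boundedProductEval (B := fun M : SpaceModel.{u} hd P => M.alg) M).comp
    (closedAdjoin {z | ∃ i j, z = universalTuple.{u} hd hP i j}).subtype

theorem toModel_gen (M : SpaceModel.{u} hd P) (i : Fin N) (j : Fin d) :
    toModel hP M (gen hd hP i j) = M.x i j :=
  rfl

theorem jointly_injective_toModel :
    Function.Injective fun (a : SpaceAlgebra.{u} hd hP) M => toModel hP M a :=
  fun _ _ h => Subtype.ext (lp.ext h)

theorem relations_gen {p : TwoColouredPartition} (hp : p ∈ P) :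
    SpaceRelations hd p (gen.{u} hd hP) :=
  .of_forall_map (toModel hP) jointly_injective_toModel fun M => M.rel p hp

-- The models of `C(X_{N,d}(P))` lie in `Type u`, hence the detour through algebras `B s : Type u`
-- for a target `A` in an arbitrary universe.
theorem exists_hom {A : Type*} [CStarAlgebra A] {I : Type*} {B : I → Type u}
    [∀ s, CStarAlgebra (B s)] [∀ s, Nontrivial (B s)] {φ : ∀ s, A →⋆ₐ[ℂ] B s}
    (hφ : Function.Injective fun a s => φ s a) {y : Fin N → Fin d → A}
    (hy : ∀ p ∈ P, SpaceRelations hd p y) :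
    ∃ Ψ : SpaceAlgebra.{u} hd hP →⋆ₐ[ℂ] A, ∀ i j, Ψ (gen hd hP i j) = y i j := by
  let M (s : I) : SpaceModel.{u} hd P := ⟨B s, fun i j => φ s (y i j), fun p hp => (hy p hp).map _⟩
  obtain ⟨Ψ, hΨ⟩ := exists_starAlgHom_of_jointly_injective hφ (fun s => toModel hP (M s))
    closedAdjoin_range_gen
    (by rintro _ ⟨i, j, rfl⟩; exact ⟨y i j, fun s => (toModel_gen (M s) i j).symm⟩)
  exact ⟨Ψ, fun i j => hφ (funext fun s => hΨ _ s)⟩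

theorem exists_permRows (σ : Equiv.Perm (Fin N)) :
    ∃ ρ : SpaceAlgebra.{u} hd hP →⋆ₐ[ℂ] SpaceAlgebra.{u} hd hP,
      ∀ i j, ρ (gen hd hP i j) = gen hd hP (σ i) j :=
  exists_hom jointly_injective_toModel fun _ hp => (relations_gen hp).permRows σ

-- `C(PUnit, ℂ)` is a copy of `ℂ` in `Type u`.
theorem exists_character (c : Fin d ↪ Fin N) :
    ∃ ε : SpaceAlgebra.{u} hd hP →⋆ₐ[ℂ] ℂ,
      ∀ i j, ε (gen hd hP i j) = (1 : Matrix (Fin N) (Fin N) ℂ) i (c j) :=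
  exists_hom (I := Unit) (B := fun _ => C(PUnit.{u + 1}, ℂ)) (φ := fun _ => StarAlgHom.ofId ℂ _)
    (fun _ _ h => FaithfulSMul.algebraMap_injective ℂ C(PUnit.{u + 1}, ℂ) (congrFun h ()))
    fun p _ => .one_columns hd p c

end SpaceAlgebra

section States

attribute [local instance] CStarAlgebra.spectralOrder CStarAlgebra.spectralOrderedRing

variable {A C : Type*} [CStarAlgebra A] [CStarAlgebra C]

theorem exists_positiveLinearMap_eq_on_selfAdjoint (g : A →ₗ[ℝ] ℝ) (hg : ∀ a, 0 ≤ a → 0 ≤ g a) :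
    ∃ f : A →ₚ[ℂ] ℂ, ∀ a, IsSelfAdjoint a → f a = g a := by
  let F : A →ₗ[ℂ] ℂ :=
    Module.Dual.extendRCLike (g ∘ₗ (selfAdjoint.submodule ℝ A).subtype ∘ₗ realPart)
  have hF : ∀ a, IsSelfAdjoint a → F a = g a := by
    intro a ha
    have hre : (realPart a : A) = a := ha.coe_realPart
    have him : (realPart (Complex.I • a) : A) = 0 := by
      rw [realPart_I_smul, ha.imaginaryPart, neg_zero, ZeroMemClass.coe_zero]
    change (g (realPart a) : ℂ) - Complex.I * g (realPart (Complex.I • a)) = g a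
    rw [hre, him, map_zero, Complex.ofReal_zero, mul_zero, sub_zero]
  refine ⟨PositiveLinearMap.mk₀ F fun a ha => ?_, hF⟩
  rw [hF a (.of_nonneg ha)]
  exact_mod_cast hg a ha

theorem exists_positiveLinearMap_apply_ne_zero {b : A} (hb : 0 ≤ b) (hb0 : b ≠ 0) :
    ∃ f : A →ₚ[ℂ] ℂ, f b ≠ 0 := by
  have hb' : -b ∉ ProperCone.positive ℝ A := fun h => hb0 (le_antisymm (neg_nonneg.mp h) hb)
  obtain ⟨g, hg, hgb⟩ := (ProperCone.positive ℝ A).hyperplane_separation_point hb'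
  obtain ⟨f, hf⟩ := exists_positiveLinearMap_eq_on_selfAdjoint (g : A →ₗ[ℝ] ℝ) hg
  refine ⟨f, ?_⟩
  rw [map_neg, neg_lt_zero] at hgb
  rw [hf b (.of_nonneg hb)]
  exact_mod_cast hgb.ne'

theorem State.exists_apply_ne_zero {b : A} (hb : 0 ≤ b) (hb0 : b ≠ 0) :
    ∃ f : State A, f.1 b ≠ 0 := by
  obtain ⟨f, hfb⟩ := exists_positiveLinearMap_apply_ne_zero hb hb0
  have hf1 : f 1 ≠ 0 := fun h => hfb <| norm_le_zero_iff.mp <| by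
    simpa [h] using f.norm_apply_le_of_nonneg b hb
  have hf1_nonneg : 0 ≤ f 1 := f.map_nonneg zero_le_one
  let f' : A →ₚ[ℂ] ℂ := PositiveLinearMap.mk₀ ((f 1)⁻¹ • f.toLinearMap) fun a ha =>
    mul_nonneg (inv_nonneg.mpr hf1_nonneg) (f.map_nonneg ha)
  exact ⟨⟨f', inv_mul_cancel₀ hf1⟩, mul_ne_zero (inv_ne_zero hf1) hfb⟩

theorem State.rep_coe (f : State A) (a : A) (x : f.1.PreGNS) :
    f.rep a (x : f.GNS) = ((f.1.toPreGNS (a * f.1.ofPreGNS x) : f.1.PreGNS) : f.GNS) :=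
  f.1.gnsNonUnitalStarAlgHom_apply_coe

theorem State.rep_vec (f : State A) (a : A) :
    f.rep a f.vec = ((f.1.toPreGNS a : f.1.PreGNS) : f.GNS) := by
  rw [State.vec, State.rep_coe, PositiveLinearMap.ofPreGNS_toPreGNS, mul_one]

theorem State.norm_rep_vec_sq (f : State A) (a : A) :
    (‖f.rep a f.vec‖ ^ 2 : ℂ) = f.1 (star a * a) := by
  rw [State.rep_vec, UniformSpace.Completion.norm_coe, PositiveLinearMap.preGNS_norm_sq,
    PositiveLinearMap.ofPreGNS_toPreGNS]

instance (f : State A) : Nontrivial f.GNS :=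
  ⟨f.vec, 0, fun h => one_ne_zero (f.norm_vec.symm.trans (by rw [h, norm_zero]))⟩

instance (f : State A) : CStarAlgebra (f.GNS →L[ℂ] f.GNS) where

theorem State.jointly_injective_rep : Function.Injective fun (a : A) (f : State A) => f.rep a := by
  intro a b hab
  by_contra hne
  have hpos := star_mul_self_nonneg (a - b)
  obtain ⟨f, hf⟩ := State.exists_apply_ne_zero hpos
    ((CStarRing.star_mul_self_ne_zero_iff _).mpr (sub_ne_zero.mpr hne))
  have hrep : f.rep (a - b) = 0 := by rw [map_sub, sub_eq_zero]; exact congrFun hab f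
  refine hf ?_
  rw [← f.norm_rep_vec_sq, hrep, zero_apply, norm_zero, Complex.ofReal_zero, zero_pow two_ne_zero]

/-- A character, regarded as a state. -/
def State.ofCharacter (ε : C →⋆ₐ[ℂ] ℂ) : State C :=
  ⟨PositiveLinearMap.mk₀ (ε : C →ₗ[ℂ] ℂ) fun _ hc => map_nonneg ε hc, map_one ε⟩

theorem State.rep_ofCharacter_vec (ε : C →⋆ₐ[ℂ] ℂ) (c : C) :
    (State.ofCharacter ε).rep c (State.ofCharacter ε).vec = ε c • (State.ofCharacter ε).vec := by
  let x := c - algebraMap ℂ C (ε c)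
  have hx : ε x = 0 := by
    rw [map_sub, AlgHomClass.commutes, Algebra.algebraMap_self_apply, sub_self]
  have hnorm : (‖(State.ofCharacter ε).rep x (State.ofCharacter ε).vec‖ ^ 2 : ℂ) = 0 := by
    rw [State.norm_rep_vec_sq]
    change ε (star x * x) = 0
    rw [map_mul, hx, mul_zero]
  have hrep : (State.ofCharacter ε).rep x (State.ofCharacter ε).vec = 0 := by
    simpa using hnorm
  rwa [map_sub, AlgHomClass.commutes, sub_apply, sub_eq_zero] at hrep

theorem State.span_vec_ofCharacter (ε : C →⋆ₐ[ℂ] ℂ) :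
    Submodule.span ℂ {(State.ofCharacter ε).vec} = ⊤ := by
  refine Submodule.eq_top_iff'.mpr fun z => ?_
  induction z using UniformSpace.Completion.induction_on with
  | hp => exact (Submodule.span ℂ {(State.ofCharacter ε).vec}).closed_of_finiteDimensional
  | ih x =>
    have h := State.rep_vec (State.ofCharacter ε) ((State.ofCharacter ε).1.ofPreGNS x)
    rw [State.rep_ofCharacter_vec, PositiveLinearMap.toPreGNS_ofPreGNS] at h
    exact Submodule.mem_span_singleton.mpr ⟨_, h⟩

theorem tensorOp_coe_tmul (s : State A × State C) (a : A) (c : C) (x : s.1.GNS) (y : s.2.GNS) :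
    tensorOp s a c ((x ⊗ₜ[ℂ] y : s.1.GNS ⊗[ℂ] s.2.GNS) : GNSTensor A C s) =
      ((s.1.rep a x ⊗ₜ[ℂ] s.2.rep c y : s.1.GNS ⊗[ℂ] s.2.GNS) : GNSTensor A C s) := by
  rw [tensorOp, ContinuousLinearMap.completion_apply_coe, TensorProduct.mapL_tmul]

/-- The isometry `x ↦ x ⊗ ξ` from the GNS space of `f` to its tensor product with the GNS space of
`g`, where `ξ` is the cyclic vector of `g`. -/
def tmulVec (f : State A) (g : State C) : f.GNS →ₗᵢ[ℂ] GNSTensor A C (f, g) where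
  toLinearMap := UniformSpace.Completion.toComplₗᵢ.toLinearMap ∘ₗ
    (TensorProduct.mk ℂ f.GNS g.GNS).flip g.vec
  norm_map' x := by
    change ‖((x ⊗ₜ[ℂ] g.vec : f.GNS ⊗[ℂ] g.GNS) : GNSTensor A C (f, g))‖ = ‖x‖
    rw [UniformSpace.Completion.norm_coe, TensorProduct.norm_tmul, g.norm_vec, mul_one]

theorem tmulVec_apply (f : State A) (g : State C) (x : f.GNS) :
    tmulVec f g x = ((x ⊗ₜ[ℂ] g.vec : f.GNS ⊗[ℂ] g.GNS) : GNSTensor A C (f, g)) :=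
  rfl

theorem tensorOp_tmulVec_ofCharacter (f : State A) (ε : C →⋆ₐ[ℂ] ℂ) (a : A) (c : C) (x : f.GNS) :
    tensorOp (f, State.ofCharacter ε) a c (tmulVec f (State.ofCharacter ε) x) =
      tmulVec f (State.ofCharacter ε) (f.rep (ε c • a) x) := by
  rw [tmulVec_apply, tensorOp_coe_tmul, State.rep_ofCharacter_vec, ← TensorProduct.smul_tmul,
    tmulVec_apply, map_smul, smul_apply]

theorem tmulVec_ofCharacter_surjective (f : State A) (ε : C →⋆ₐ[ℂ] ℂ) :
    Function.Surjective (tmulVec f (State.ofCharacter ε)) := by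
  let V := tmulVec f (State.ofCharacter ε)
  intro z
  change z ∈ V.range
  induction z using UniformSpace.Completion.induction_on with
  | hp => exact V.isometry.isClosedEmbedding.isClosed_range
  | ih z =>
    induction z using TensorProduct.induction_on with
    | zero => exact zero_mem _
    | add x y hx hy =>
      rw [UniformSpace.Completion.coe_add]
      exact add_mem hx hy
    | tmul x y =>
      obtain ⟨r, rfl⟩ : ∃ r : ℂ, r • (State.ofCharacter ε).vec = y :=
        Submodule.mem_span_singleton.mp (State.span_vec_ofCharacter ε ▸ trivial)
      refine ⟨r • x, ?_⟩
      rw [← TensorProduct.smul_tmul]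
      rfl

namespace MinTensor

theorem closedAdjoin_tmul :
    closedAdjoin {z : MinTensor A C | ∃ a c, z = tmul a c} = ⊤ := by
  refine Eq.trans (congrArg closedAdjoin ?_) (closedAdjoin_preimage_coe
    {z : GNSTensorProduct A C | ∃ a c, z = elemTensor a c})
  exact Set.ext fun z => exists₂_congr fun a c => Subtype.ext_iff

/-- The representation of the minimal tensor product on the Hilbert space tensor product of the GNS
spaces of two states. -/
def rep (s : State A × State C) :
    MinTensor A C →⋆ₐ[ℂ] (GNSTensor A C s →L[ℂ] GNSTensor A C s) :=
  (boundedProductEval (B := fun s => GNSTensor A C s →L[ℂ] GNSTensor A C s) s).comp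
    (closedAdjoin {z : GNSTensorProduct A C | ∃ a c, z = elemTensor a c}).subtype

theorem rep_tmul (s : State A × State C) (a : A) (c : C) : rep s (tmul a c) = tensorOp s a c :=
  rfl

theorem exists_slice (ε : C →⋆ₐ[ℂ] ℂ) :
    ∃ S : MinTensor A C →⋆ₐ[ℂ] A, ∀ a c, S (tmul a c) = ε c • a := by
  let V (f : State A) : f.GNS ≃ₗᵢ[ℂ] GNSTensor A C (f, State.ofCharacter ε) :=
    .ofSurjective _ (tmulVec_ofCharacter_surjective f ε)
  let Φ (f : State A) : MinTensor A C →⋆ₐ[ℂ] (f.GNS →L[ℂ] f.GNS) :=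
    (V f).conjStarAlgEquiv.symm.toStarAlgHom.comp (rep (f, State.ofCharacter ε))
  have hΦ (a : A) (c : C) (f : State A) : f.rep (ε c • a) = Φ f (tmul a c) := by
    ext x
    refine (V f).injective ?_
    calc V f (f.rep (ε c • a) x) = tensorOp (f, State.ofCharacter ε) a c (V f x) :=
          (tensorOp_tmulVec_ofCharacter f ε a c x).symm
      _ = rep (f, State.ofCharacter ε) (tmul a c) (V f x) := by rw [rep_tmul]
      _ = V f (Φ f (tmul a c) x) := ((V f).apply_symm_apply _).symm
  obtain ⟨S, hS⟩ := exists_starAlgHom_of_jointly_injective State.jointly_injective_rep Φ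
    closedAdjoin_tmul (by rintro _ ⟨a, c, rfl⟩; exact ⟨_, hΦ a c⟩)
  exact ⟨S, fun a c => State.jointly_injective_rep (funext fun f => (hS _ f).trans (hΦ a c f).symm)⟩

end MinTensor

end States

section Actions

variable {A : Type*} [CStarAlgebra A] {N d : ℕ} {hd : d ≤ N} {P : Set TwoColouredPartition}
  {hP : mixedColouredPairPartitions ⊆ P} {v : Matrix (Fin N) (Fin N) A}

theorem hasRightAction_iff_hasLeftAction_transpose {C : Type*} [CStarAlgebra C]
    {x : Fin N → Fin d → C} : HasRightAction v x ↔ HasLeftAction v.transpose x :=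
  Iff.rfl

theorem HasLeftAction.existsUnique_hom (h : HasLeftAction v (SpaceAlgebra.gen.{u} hd hP))
    (σ : Equiv.Perm (Fin N)) (c : Fin d ↪ Fin N) :
    ∃! φ : SpaceAlgebra.{u} hd hP →⋆ₐ[ℂ] A,
      ∀ i j, φ (SpaceAlgebra.gen hd hP i j) = v (σ i) (c j) := by
  obtain ⟨α, hα⟩ := h
  obtain ⟨ρ, hρ⟩ := SpaceAlgebra.exists_permRows (hd := hd) (hP := hP) σ
  obtain ⟨ε, hε⟩ := SpaceAlgebra.exists_character (hd := hd) (hP := hP) c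
  obtain ⟨S, hS⟩ := MinTensor.exists_slice (A := A) ε
  have hφ (i : Fin N) (j : Fin d) :
      (S.comp (α.comp ρ)) (SpaceAlgebra.gen hd hP i j) = v (σ i) (c j) := by
    calc (S.comp (α.comp ρ)) (SpaceAlgebra.gen hd hP i j)
      _ = S (α (SpaceAlgebra.gen hd hP (σ i) j)) := by
          rw [StarAlgHom.comp_apply, StarAlgHom.comp_apply, hρ]
      _ = ∑ k, (1 : Matrix (Fin N) (Fin N) ℂ) k (c j) • v (σ i) k := by
          simp only [hα, map_sum, hS, hε]
      _ = v (σ i) (c j) := by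
          simp only [Matrix.one_apply, ite_smul, one_smul, zero_smul, Finset.sum_ite_eq',
            Finset.mem_univ, if_true]
  exact ⟨S.comp (α.comp ρ), hφ, fun ψ hψ =>
    SpaceAlgebra.hom_ext fun i j => (hψ i j).trans (hφ i j).symm⟩

theorem HasLeftAction.spaceRelations_columns (h : HasLeftAction v (SpaceAlgebra.gen.{u} hd hP))
    {p : TwoColouredPartition} (hp : p ∈ P) (c : Fin d ↪ Fin N) :
    SpaceRelations hd p (fun i j => v i (c j)) := by
  obtain ⟨φ, hφ, -⟩ := h.existsUnique_hom 1 c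
  simpa only [hφ, Equiv.Perm.coe_one, id_eq] using (SpaceAlgebra.relations_gen hp).map φ

end Actions

end PartitionQuantumSpace

end

theorem mainTheorem3_general (N d : ℕ) (hd : d ≤ N)
    (P : Set TwoColouredPartition) (hP : mixedColouredPairPartitions ⊆ P)
    (A : Type*) [CStarAlgebra A] (v : Matrix (Fin N) (Fin N) A)
    (hleft : HasLeftAction v (SpaceAlgebra.gen.{u} hd hP))
    (hright : HasRightAction v (SpaceAlgebra.gen.{u} hd hP)) :
    (∀ σ₁ σ₂ : Equiv.Perm (Fin N),
      (∃! φ : SpaceAlgebra.{u} hd hP →⋆ₐ[ℂ] A,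
        ∀ i j, φ (SpaceAlgebra.gen hd hP i j) = v (σ₁ i) (σ₂ (Fin.castLE hd j))) ∧
      (∃! φT : SpaceAlgebra.{u} hd hP →⋆ₐ[ℂ] A,
        ∀ i j, φT (SpaceAlgebra.gen hd hP i j) = v (σ₂ (Fin.castLE hd j)) (σ₁ i))) ∧
    (∃! φ : SpaceAlgebra.{u} hd hP →⋆ₐ[ℂ] A,
      ∀ i j, φ (SpaceAlgebra.gen hd hP i j) = v i (Fin.castLE hd j)) ∧
    (∀ p ∈ P, ∀ c : Fin d ↪ Fin N,
      SpaceRelations hd p (fun i j => v i (c j)) ∧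
      SpaceRelations hd p (fun i j => v (c j) i)) := by
  have hright' := hasRightAction_iff_hasLeftAction_transpose.mp hright
  refine ⟨fun σ₁ σ₂ => ?_, hleft.existsUnique_hom 1 (Fin.castLEEmb hd), fun p hp c =>
    ⟨hleft.spaceRelations_columns hp c, hright'.spaceRelations_columns hp c⟩⟩
  let c : Fin d ↪ Fin N := (Fin.castLEEmb hd).trans σ₂.toEmbedding
  exact ⟨hleft.existsUnique_hom σ₁ c, hright'.existsUnique_hom σ₁ c⟩

theorem mainTheorem3 (N d : ℕ) (hd₁ : 1 ≤ d) (hd : d ≤ N)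
    (P : Set TwoColouredPartition) (hP : mixedColouredPairPartitions ⊆ P)
    (A : Type u) [CStarAlgebra A] (v : Matrix (Fin N) (Fin N) A)
    (hG : IsQuantumSymmetryGroup v (SpaceAlgebra.gen.{u} hd hP)) :
    (∀ σ₁ σ₂ : Equiv.Perm (Fin N),
      (∃! φ : SpaceAlgebra.{u} hd hP →⋆ₐ[ℂ] A,
        ∀ i j, φ (SpaceAlgebra.gen hd hP i j) = v (σ₁ i) (σ₂ (Fin.castLE hd j))) ∧
      (∃! φT : SpaceAlgebra.{u} hd hP →⋆ₐ[ℂ] A,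
        ∀ i j, φT (SpaceAlgebra.gen hd hP i j) = v (σ₂ (Fin.castLE hd j)) (σ₁ i))) ∧
    (∃! φ : SpaceAlgebra.{u} hd hP →⋆ₐ[ℂ] A,
      ∀ i j, φ (SpaceAlgebra.gen hd hP i j) = v i (Fin.castLE hd j)) ∧
    (∀ p ∈ P, ∀ c : Fin d ↪ Fin N,
      SpaceRelations hd p (fun i j => v i (c j)) ∧
      SpaceRelations hd p (fun i j => v (c j) i)) :=
  mainTheorem3_general N d hd P hP A v hG.left hG.right
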